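/- For a finite lattice $D$ let $J(D)$ be the set of its nonzero join-irreducible elements and put $J^+(D)=J(D)\cup\{0,1\}$. An algebra is a nonempty, possibly infinite, set with an arbitrary family of finitary operations; $\operatorname{Con}(A)$ denotes the lattice of congruences of an algebra $A$, and $\operatorname{Princ}(A)$ the set of its principal congruences, i.e. those generated by a single pair of elements of $A$. For $Q\subseteq D$, the algebra $A$ \emph{represents} the inclusion $Q\subseteq D$ by principal congruences if there is a lattice isomorphism $\varphi\colon\operatorname{Con}(A)\to D$ with $Q=\varphi(\operatorname{Princ}(A))$. A finite lattice is \emph{planar} if it has a Hasse diagram in the plane (larger elements placed higher, coverings drawn as straight line segments) whose edges meet only at common endpoints. An element is \emph{join-reducible} if it is the join of two strictly smaller elements; a coatom is a maximal element of $D\setminus\{1\}$. \textbf{Theorem.} Let $D$ be a finite (nonempty) distributive lattice, and consider the following conditions on $D$. \begin{enumerate} \item[(i)] For every $Q$ with $J^+(D)\subseteq Q\subseteq D$, the inclusion $Q\subseteq D$ is represented by the principal congruences of some algebra $A$ (depending on $Q$). \item[(ii)] For every $Q$ with $J^+(D)\subseteq Q\subseteq D$, the inclusion $Q\subseteq D$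 is represented by the principal congruences of some finite lattice $L$ (depending on $Q$), regarded as an algebra $(L,\vee,\wedge)$. \item[(iii)] $D$ is planar and has at most one join-reducible coatom. \end{enumerate} Then (i) implies (iii), and (ii) implies (i). -/

import Mathlib

universe u v w k

namespace PrincRep

section Algebras

variable (L : FirstOrder.Language.{w, 0}) (A : Type v) [L.Structure A]

/-- An equivalence relation on `A` that is compatible with all basic operations of `A`. -/
def IsCongruence (s : Setoid A) : Prop :=
  ∀ (n : ℕ) (f : L.Functions n) (x y : Fin n → A),
    (∀ i, s (x i) (y i)) →
      s (FirstOrder.Language.Structure.funMap f x)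
        (FirstOrder.Language.Structure.funMap f y)

/-- `Con(A)`, the congruences of the algebra `A`, ordered by inclusion. -/
abbrev Congr : Type v := {s : Setoid A // IsCongruence L A s}

variable {A}

/-- `con(a, b)`, the smallest congruence of `A` that contains the pair `(a, b)`. -/
def con (a b : A) : Congr L A :=
  ⟨sInf {s : Setoid A | IsCongruence L A s ∧ s a b},
    fun n f x y h s hs => hs.1 n f x y fun i => h i s hs⟩

variable (A)

/-- `Princ(A)`, the set of principal congruences of `A`. -/
def Princ : Set (Congr L A) := {θ | ∃ a b : A, θ = con L a b}

/-- The algebra `A` represents the inclusion `Q ⊆ D` by principal congruences. -/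
def Represents {D : Type u} [Lattice D] (Q : Set D) : Prop :=
  ∃ φ : Congr L A ≃o D, Q = φ '' Princ L A

end Algebras

/-- The two binary operation symbols of lattices. -/
inductive LatticeOp : ℕ → Type
  | join : LatticeOp 2
  | meet : LatticeOp 2

/-- The signature of lattices, considered as algebras `(K, ∨, ∧)`. -/
def latticeLanguage : FirstOrder.Language.{0, 0} := ⟨LatticeOp, fun _ => Empty⟩

/-- A lattice, considered as an algebra `(K, ∨, ∧)`. -/
instance latticeStructure (K : Type v) [Lattice K] : latticeLanguage.Structure K where
  funMap := fun {_} f =>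
    match f with
    | LatticeOp.join => fun x => x 0 ⊔ x 1
    | LatticeOp.meet => fun x => x 0 ⊓ x 1
  RelMap := fun {_} r => r.elim

section Lattices

variable (D : Type u) [Lattice D]

/-- `J⁺(D)`: the (nonzero) join-irreducible elements together with `0` and `1`. -/
def JPlus [BoundedOrder D] : Set D := {x | SupIrred x} ∪ {⊥, ⊤}

/-- Every `Q` with `J⁺(D) ⊆ Q ⊆ D` is represented by the principal congruences of some
(nonempty, possibly infinite) algebra; the algebra and its signature may depend on `Q`. -/
def FullyAlgebraRepresentable [BoundedOrder D] : Prop :=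
  ∀ Q : Set D, JPlus D ⊆ Q →
    ∃ (L : FirstOrder.Language.{w, 0}) (_ : L.IsAlgebraic) (A : Type v) (_ : Nonempty A)
      (_ : L.Structure A), Represents L A Q

/-- Every `Q` with `J⁺(D) ⊆ Q ⊆ D` is represented by the principal congruences of some
finite lattice. -/
def FullyFiniteLatticeRepresentable [BoundedOrder D] : Prop :=
  ∀ Q : Set D, JPlus D ⊆ Q →
    ∃ (K : Type v) (_ : Lattice K) (_ : Finite K) (_ : Nonempty K),
      Represents latticeLanguage K Q

variable {D}

/-- A planar Hasse diagram: distinct elements are distinct points of the plane, a larger element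
is placed higher, coverings `a ⋖ b` are drawn as straight line segments, an edge passes
through no vertex but its two ends, and two distinct edges meet only at common ends. -/
structure IsPlanarDiagram (f : D → ℝ × ℝ) : Prop where
  injective : Function.Injective f
  upward : ∀ ⦃a b : D⦄, a < b → (f a).2 < (f b).2
  vertex_edge : ∀ ⦃a b x : D⦄, a ⋖ b → f x ∈ segment ℝ (f a) (f b) → x = a ∨ x = b
  edge_edge : ∀ ⦃a b c d : D⦄, a ⋖ b → c ⋖ d → (a, b) ≠ (c, d) →
    segment ℝ (f a) (f b) ∩ segment ℝ (f c) (f d) ⊆ f '' (({a, b} : Set D) ∩ {c, d})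

variable (D)

/-- A lattice is planar if it is finite and has a planar Hasse diagram. -/
def IsPlanar : Prop := Finite D ∧ ∃ f : D → ℝ × ℝ, IsPlanarDiagram f

variable {D}

/-- `c` is the join of two strictly smaller elements. -/
def JoinReducible (c : D) : Prop := ∃ a b : D, a < c ∧ b < c ∧ a ⊔ b = c

end Lattices

end PrincRep

/-! Congruences join as equivalence relations, so a pair in `d ⊔ e` is linked by a path of steps in
`d` or `e`; `IsCongDist` keeps just this. Both obstructions take `Q` to be `J⁺(D)` plus one element
`m` and examine the step at which a path leaves a set around `a`, where `con(a, b)` is `m`. With `m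
= p ⊔ q ⊔ r` there can be no 3-antichain of join-irreducibles; with `m = c ⊓ d` there cannot be two
join-reducible coatoms.

Planarity follows from the first: by Dilworth the join-irreducibles split into two chains, and
counting those below an element embeds `D` in the integer grid with coverings as unit edges.

A finite lattice is itself an algebra, so the second implication is only a change of universe. -/

namespace PrincRep

/-! ### Joins of congruences and crossing steps. -/

section Congruences

variable {L : FirstOrder.Language.{w, 0}} {A : Type v} [L.Structure A]

theorem con_rel (a b : A) : (con L a b).1 a b := fun _ hs => hs.2

theorem con_le_iff {a b : A} {θ : Congr L A} : con L a b ≤ θ ↔ θ.1 a b :=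
  ⟨fun h => h (con_rel a b), fun h _ _ hxy => hxy θ.1 ⟨θ.2, h⟩⟩

/-- The join of two congruences in the lattice of equivalence relations is a congruence. -/
theorem IsCongruence.sup {r s : Setoid A} (hr : IsCongruence L A r) (hs : IsCongruence L A s) :
    IsCongruence L A (r ⊔ s) := by
  classical
  intro n f x y h
  -- Arguments are changed one at a time: the pullback of `r ⊔ s` along a unary translation contains
  -- `r` and `s`, hence `r ⊔ s`.
  have key : ∀ (z : Fin n → A) (i : Fin n) (b : A), (r ⊔ s) (z i) b →
      (r ⊔ s) (FirstOrder.Language.Structure.funMap f z)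
        (FirstOrder.Language.Structure.funMap f (Function.update z i b)) := by
    intro z i b hb
    have aux : ∀ t : Setoid A, IsCongruence L A t → t ≤ r ⊔ s → t ≤ (r ⊔ s).comap
        (fun c => FirstOrder.Language.Structure.funMap f (Function.update z i c)) := by
      intro t ht hle c d hcd
      refine hle (ht n f _ _ fun j => ?_)
      by_cases hj : j = i
      · subst hj; simpa using hcd
      · simp [hj]
    have := sup_le (aux r hr le_sup_left) (aux s hs le_sup_right) hb
    simpa [Setoid.comap_rel] using this
  have step : ∀ t : Finset (Fin n), (r ⊔ s) (FirstOrder.Language.Structure.funMap f x)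
      (FirstOrder.Language.Structure.funMap f (t.piecewise y x)) := by
    intro t
    induction t using Finset.induction_on with
    | empty => simp
    | insert i t hi ih =>
      rw [Finset.piecewise_insert]
      refine (r ⊔ s).trans' ih (key _ i _ ?_)
      simpa [hi] using h i
  simpa using step Finset.univ

/-- A path of `r`- and `s`-steps that leaves a set `P` has a step that leaves `P`. -/
theorem exists_crossing {r s : Setoid A} {P : Set A} {a z : A} (h : (r ⊔ s) a z) (ha : a ∈ P)
    (hz : z ∉ P) : ∃ x ∈ P, ∃ y ∉ P, r x y ∨ s x y := by
  by_contra! hc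
  -- With no crossing step, both relations refine the partition into `P` and its complement, and so
  -- does their join.
  have aux : ∀ t : Setoid A, (∀ x ∈ P, ∀ y ∉ P, ¬ t x y) → t ≤ Setoid.ker (· ∈ P) := by
    intro t ht x y hxy
    refine propext ⟨fun hx => ?_, fun hy => ?_⟩
    · by_contra hy
      exact ht x hx y hy hxy
    · by_contra hx
      exact ht y hy x hx (t.symm' hxy)
  have hker := sup_le (aux r fun x hx y hy => (hc x hx y hy).1)
    (aux s fun x hx y hy => (hc x hx y hy).2) h
  have hker' : (a ∈ P) = (z ∈ P) := hker
  exact hz (hker' ▸ ha)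

end Congruences

/-- A distance with values in a lattice; the principal congruences of an algebra give one whose
range is the represented subset. -/
structure IsCongDist {A : Type v} {D : Type u} [Lattice D] [OrderBot D] (δ : A → A → D) :
    Prop where
  self : ∀ a, δ a a = ⊥
  comm : ∀ a b, δ a b = δ b a
  triangle : ∀ a b c, δ a c ≤ δ a b ⊔ δ b c
  crossing : ∀ (P : Set A) (a z : A) (d e : D), δ a z ≤ d ⊔ e → a ∈ P → z ∉ P →
    ∃ x ∈ P, ∃ y ∉ P, δ x y ≤ d ∨ δ x y ≤ e

theorem Represents.exists_isCongDist {L : FirstOrder.Language.{w, 0}} {A : Type v} [L.Structure A]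
    {D : Type u} [Lattice D] [OrderBot D] {Q : Set D} (h : Represents L A Q) :
    ∃ δ : A → A → D, IsCongDist δ ∧ ∀ d, d ∈ Q ↔ ∃ a b, δ a b = d := by
  obtain ⟨φ, rfl⟩ := h
  have hle : ∀ a b d, φ (con L a b) ≤ d ↔ (φ.symm d).1 a b := fun a b d => by
    rw [← con_le_iff, OrderIso.le_symm_apply]
  refine ⟨fun a b => φ (con L a b), ⟨?_, ?_, ?_, ?_⟩, ?_⟩
  · intro a
    exact le_bot_iff.1 ((hle _ _ _).2 (Setoid.refl' _ _))
  · have : ∀ a b, φ (con L a b) ≤ φ (con L b a) := fun a b =>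
      φ.monotone (con_le_iff.2 (Setoid.symm' _ (con_rel b a)))
    exact fun a b => le_antisymm (this a b) (this b a)
  · intro a b c
    rw [hle]
    exact Setoid.trans' _ ((hle a b _).1 le_sup_left) ((hle b c _).1 le_sup_right)
  · intro P a z d e haz ha hz
    let θ : Congr L A := ⟨(φ.symm d).1 ⊔ (φ.symm e).1, (φ.symm d).2.sup (φ.symm e).2⟩
    have hd : d ≤ φ θ := by
      rw [← OrderIso.symm_apply_le]
      exact (le_sup_left : (φ.symm d).1 ≤ (φ.symm d).1 ⊔ (φ.symm e).1)
    have he : e ≤ φ θ := by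
      rw [← OrderIso.symm_apply_le]
      exact (le_sup_right : (φ.symm e).1 ≤ (φ.symm d).1 ⊔ (φ.symm e).1)
    have hθ : θ.1 a z := con_le_iff.1 (φ.le_iff_le.1 (haz.trans (sup_le hd he)))
    simpa only [hle] using exists_crossing hθ ha hz
  · intro d
    constructor
    · rintro ⟨_, ⟨a, b, rfl⟩, rfl⟩
      exact ⟨a, b, rfl⟩
    · rintro ⟨a, b, rfl⟩
      exact ⟨_, ⟨a, b, rfl⟩, rfl⟩

theorem JoinReducible.not_supIrred {D : Type u} [Lattice D] {c : D} (h : JoinReducible c) :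
    ¬ SupIrred c := by
  obtain ⟨a, b, ha, hb, rfl⟩ := h
  intro hc
  rcases hc.2 rfl with h | h
  · exact ha.ne h
  · exact hb.ne h

/-! ### Necessary conditions from one extra principal congruence. -/

section Obstructions

variable {D : Type u} [DistribLattice D] [BoundedOrder D]

theorem FullyAlgebraRepresentable.exists_isCongDist
    (h : FullyAlgebraRepresentable.{u, v, w} D) (m : D) :
    ∃ (A : Type v) (δ : A → A → D), IsCongDist δ ∧
      ∀ d, (SupIrred d ∨ d = ⊥ ∨ d = ⊤ ∨ d = m) ↔ ∃ a b, δ a b = d := by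
  obtain ⟨L, _, A, _, _, hrep⟩ := h (JPlus D ∪ {m}) Set.subset_union_left
  obtain ⟨δ, hδ, hQ⟩ := hrep.exists_isCongDist
  refine ⟨A, δ, hδ, fun d => ?_⟩
  rw [← hQ]
  simp only [JPlus, Set.mem_union, Set.mem_ofPred_eq, Set.mem_insert_iff, Set.mem_singleton_iff,
    or_assoc]

/-- A path from `a` to `b` leaves `P` by a step `x, y` with `δ a y = m`. Then `m ≤ δ a x ⊔ δ x y`,
where each term lies below one of `p, q, r`. By join-primeness each of the three lies below one of
the two terms, which is impossible for an antichain. -/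
theorem FullyAlgebraRepresentable.not_antichain_three
    (h : FullyAlgebraRepresentable.{u, v, w} D) {p q r : D} (hp : SupIrred p) (hq : SupIrred q)
    (hr : SupIrred r) : p ≤ q ∨ q ≤ p ∨ p ≤ r ∨ r ≤ p ∨ q ≤ r ∨ r ≤ q := by
  by_contra! hanti
  obtain ⟨hpq, hqp, hpr, hrp, hqr, hrq⟩ := hanti
  obtain ⟨A, δ, hδ, hQ⟩ := h.exists_isCongDist (p ⊔ q ⊔ r)
  set m := p ⊔ q ⊔ r with hm
  have hpm : p ≤ m := le_sup_left.trans le_sup_left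
  have hqm : q ≤ m := le_sup_right.trans le_sup_left
  have hrm : r ≤ m := le_sup_right
  have hirr : ∀ j, SupIrred j → j ≤ m → j ≤ p ∨ j ≤ q ∨ j ≤ r := fun j hj hjm => by
    rwa [hm, hj.supPrime.le_sup, hj.supPrime.le_sup, or_assoc] at hjm
  have hmJ : ¬ SupIrred m := fun hmJ => by
    rcases hirr m hmJ le_rfl with h | h | h
    · exact hqp (hqm.trans h)
    · exact hpq (hpm.trans h)
    · exact hpr (hpm.trans h)
  have hm0 : m ≠ ⊥ := fun h0 => hp.ne_bot (le_bot_iff.1 (h0 ▸ hpm))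
  obtain ⟨a, b, hab⟩ := (hQ m).1 (by simp)
  let P : Set A := {x | (SupIrred (δ a x) ∨ δ a x = ⊥) ∧ δ a x ≤ m}
  have ha : a ∈ P := ⟨Or.inr (hδ.self a), by rw [hδ.self]; exact bot_le⟩
  have hb : b ∉ P := fun hb => by
    rcases hb.1 with h | h
    · exact hmJ (hab ▸ h)
    · exact hm0 (hab ▸ h)
  obtain ⟨x, hx, y, hy, hxy⟩ : ∃ x ∈ P, ∃ y ∉ P, δ x y ≤ p ∨ δ x y ≤ q ∨ δ x y ≤ r := by
    obtain ⟨x, hx, y, hy, hxy⟩ := hδ.crossing P a b (p ⊔ q) r hab.le ha hb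
    rcases hxy with hxy | hxy
    · obtain ⟨x, hx, y, hy, hxy⟩ := hδ.crossing P x y p q hxy hx hy
      exact ⟨x, hx, y, hy, hxy.elim Or.inl fun h => Or.inr (Or.inl h)⟩
    · exact ⟨x, hx, y, hy, Or.inr (Or.inr hxy)⟩
  have hxym : δ x y ≤ m := by
    rcases hxy with h | h | h
    · exact h.trans hpm
    · exact h.trans hqm
    · exact h.trans hrm
  have haym : δ a y ≤ m := (hδ.triangle a x y).trans (sup_le hx.2 hxym)
  have hay : δ a y = m := by
    rcases (hQ (δ a y)).2 ⟨a, y, rfl⟩ with h | h | h | h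
    · exact absurd ⟨Or.inl h, haym⟩ hy
    · exact absurd ⟨Or.inr h, haym⟩ hy
    · exact le_antisymm haym (h ▸ le_top)
    · exact h
  have hle : m ≤ δ a x ⊔ δ x y := hay ▸ hδ.triangle a x y
  have hp' := hp.supPrime.le_sup.1 (hpm.trans hle)
  have hq' := hq.supPrime.le_sup.1 (hqm.trans hle)
  have hr' := hr.supPrime.le_sup.1 (hrm.trans hle)
  have hu : δ a x ≤ p ∨ δ a x ≤ q ∨ δ a x ≤ r := by
    rcases hx.1 with h | h
    · exact hirr _ h hx.2
    · exact Or.inl (h ▸ bot_le)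
  generalize δ a x = s at *
  generalize δ x y = t at *
  rcases hu with hu | hu | hu <;> rcases hxy with ht | ht | ht <;>
    rcases hp' with hp' | hp' <;> rcases hq' with hq' | hq' <;> rcases hr' with hr' | hr' <;>
    first
    | exact hpq (hp'.trans hu) | exact hpr (hp'.trans hu) | exact hqp (hq'.trans hu)
    | exact hqr (hq'.trans hu) | exact hrp (hr'.trans hu) | exact hrq (hr'.trans hu)
    | exact hpq (hp'.trans ht) | exact hpr (hp'.trans ht) | exact hqp (hq'.trans ht)
    | exact hqr (hq'.trans ht) | exact hrp (hr'.trans ht) | exact hrq (hr'.trans ht)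

/-- If a congruence below the meet `m` of two coatoms is generated by `a, b`, and `y` is related to
`a` modulo the coatom `c` but not modulo `m`, then `c` is join-irreducible. -/
theorem IsCongDist.supIrred_coatom {A : Type v} {δ : A → A → D} (hδ : IsCongDist δ) {c d : D}
    (hc : IsCoatom c) (hd : IsCoatom d) (hcd : c ≠ d)
    (hQ : ∀ a b, SupIrred (δ a b) ∨ δ a b = ⊥ ∨ δ a b = ⊤ ∨ δ a b = c ⊓ d) {a b y : A}
    (hab : δ a b = c ⊓ d) (hy : δ a y ≤ c) (hy' : ¬ δ a y ≤ c ⊓ d) : SupIrred c := by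
  have hcov : c ⊓ d ⋖ c := by
    apply inf_covBy_of_covBy_sup_right
    rw [hc.sup_eq_top_of_ne hd hcd]
    exact hd.covBy_top
  have hirr : ∀ {x}, δ x y ≤ c → ¬ δ x y ≤ c ⊓ d → SupIrred (δ x y) := fun {x} h h' => by
    rcases hQ x y with h1 | h1 | h1 | h1
    · exact h1
    · exact absurd (h1 ▸ bot_le) h'
    · exact absurd (top_le_iff.1 (h1 ▸ h)) hc.1
    · exact absurd h1.le h'
  have hsup : ∀ {x}, x ≤ c → ¬ x ≤ c ⊓ d → c ⊓ d ⊔ x = c := fun {x} h h' =>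
    (hcov.eq_or_eq le_sup_left (sup_le hcov.le h)).resolve_left fun h1 =>
      h' (h1 ▸ le_sup_right)
  have hby : δ b y ≤ c := (hδ.triangle b a y).trans
    (sup_le (by rw [hδ.comm, hab]; exact inf_le_left) hy)
  have hby' : ¬ δ b y ≤ c ⊓ d := fun h =>
    hy' ((hδ.triangle a b y).trans (sup_le hab.le h))
  have hs := hirr hy hy'
  have ht := hirr hby hby'
  -- A covering adds only one join-irreducible, so the two agree. The triangle through `y` then puts
  -- `c ⊓ d` below `δ a y`, which must equal `c`.
  have hst : δ a y = δ b y := le_antisymm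
    ((hs.supPrime.le_sup.1 (hy.trans (hsup hby hby').ge)).resolve_left hy')
    ((ht.supPrime.le_sup.1 (hby.trans (hsup hy hy').ge)).resolve_left hby')
  have hms : c ⊓ d ≤ δ a y := by
    rw [← hab]
    exact (hδ.triangle a y b).trans (sup_le le_rfl (by rw [hδ.comm, hst]))
  rwa [← hsup hy hy', sup_eq_right.2 hms]

theorem FullyAlgebraRepresentable.subsingleton_joinReducible_coatom
    (h : FullyAlgebraRepresentable.{u, v, w} D) :
    {c : D | IsCoatom c ∧ JoinReducible c}.Subsingleton := by
  rintro c ⟨hc, hcr⟩ d ⟨hd, hdr⟩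
  by_contra hcd
  obtain ⟨A, δ, hδ, hQ⟩ := h.exists_isCongDist (c ⊓ d)
  have hQ' : ∀ a b, SupIrred (δ a b) ∨ δ a b = ⊥ ∨ δ a b = ⊤ ∨ δ a b = c ⊓ d := fun a b =>
    (hQ _).2 ⟨a, b, rfl⟩
  obtain ⟨a, b, hab⟩ := (hQ (c ⊓ d)).1 (by simp)
  obtain ⟨s, t, hst⟩ := (hQ ⊤).1 (by simp)
  -- Otherwise all elements are related modulo `c ⊓ d`, though `⊤` is generated by `s, t`.
  obtain ⟨z, hz⟩ : ∃ z, ¬ δ a z ≤ c ⊓ d := by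
    by_contra! hall
    have := (hδ.triangle s a t).trans (sup_le (by rw [hδ.comm]; exact hall s) (hall t))
    rw [hst] at this
    exact hc.1 (top_le_iff.1 (this.trans inf_le_left))
  obtain ⟨x, hx, y, hy, hxy⟩ := hδ.crossing {x | δ a x ≤ c ⊓ d} a z c d
    (by rw [hc.sup_eq_top_of_ne hd hcd]; exact le_top)
    (by simp only [Set.mem_ofPred_eq, hδ.self]; exact bot_le) hz
  rcases hxy with hxy | hxy
  · exact hcr.not_supIrred (hδ.supIrred_coatom hc hd hcd hQ' hab
      ((hδ.triangle a x y).trans (sup_le (hx.trans inf_le_left) hxy)) hy)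
  · simp only [Set.mem_ofPred_eq, inf_comm c d] at hQ' hab hy hx
    exact hdr.not_supIrred (hδ.supIrred_coatom hd hc (Ne.symm hcd) hQ' hab
      ((hδ.triangle a x y).trans (sup_le (hx.trans inf_le_left) hxy)) hy)

end Obstructions

/-! ### Covering a poset of width two by two chains. -/

section Width

variable {α : Type u} [PartialOrder α]

/-- Elements of `A` not below `x` are comparable to all of `B`, so they can move to `B`; the rest of
`A` lies below `a`. -/
theorem isChain_insert_of_greatest_incomparable {s A B : Set α} {a x : α}
    (hA : IsChain (· ≤ ·) A) (hB : IsChain (· ≤ ·) B) (hs : s ⊆ insert a (A ∪ B)) (hxa : x ≤ a)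
    (hx : ∀ z ∈ A, (∃ y ∈ B, ¬ z ≤ y ∧ ¬ y ≤ z) → z ≤ x) :
    ∃ A' B' : Set α, IsChain (· ≤ ·) A' ∧ IsChain (· ≤ ·) B' ∧ s ⊆ A' ∪ B' := by
  refine ⟨insert a {z ∈ A | z ≤ x}, {z ∈ A | ¬ z ≤ x} ∪ B, ?_, ?_, ?_⟩
  · exact (hA.mono fun z hz => hz.1).insert fun z hz _ => Or.inr (hz.2.trans hxa)
  · have key : ∀ z ∈ {z ∈ A | ¬ z ≤ x}, ∀ y ∈ B, z ≤ y ∨ y ≤ z := fun z hz y hy => by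
      by_contra! hc
      exact hz.2 (hx z hz.1 ⟨y, hy, hc⟩)
    rintro z (hz | hz) y (hy | hy) hne
    · exact hA hz.1 hy.1 hne
    · exact key z hz y hy
    · exact (key y hy z hz).symm
    · exact hB hz hy hne
  · intro z hz
    rcases hs hz with rfl | hz | hz
    · exact Or.inl (Or.inl rfl)
    · by_cases h : z ≤ x
      · exact Or.inl (Or.inr ⟨hz, h⟩)
      · exact Or.inr (Or.inl ⟨hz, h⟩)
    · exact Or.inr (Or.inr hz)

theorem _root_.IsChain.exists_greatest_of_finite {A : Set α} (hA : IsChain (· ≤ ·) A) (hf : A.Finite)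
    (hne : A.Nonempty) : ∃ x ∈ A, ∀ z ∈ A, z ≤ x := by
  obtain ⟨x, hx⟩ := hf.exists_maximal hne
  refine ⟨x, hx.prop, fun z hz => ?_⟩
  rcases eq_or_ne z x with rfl | hne
  · exact le_rfl
  · exact (hA hz hx.prop hne).elim id fun h => hx.le_of_ge hz h

/-- Dilworth's theorem for width two. -/
theorem exists_two_chains (s : Finset α)
    (h : ∀ x ∈ s, ∀ y ∈ s, ∀ z ∈ s, x ≤ y ∨ y ≤ x ∨ x ≤ z ∨ z ≤ x ∨ y ≤ z ∨ z ≤ y) :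
    ∃ A B : Set α, IsChain (· ≤ ·) A ∧ IsChain (· ≤ ·) B ∧ (s : Set α) ⊆ A ∪ B := by
  classical
  induction s using Finset.strongInduction with
  | H s ih =>
  rcases s.eq_empty_or_nonempty with rfl | hne
  · exact ⟨∅, ∅, IsChain.empty, IsChain.empty, by simp⟩
  obtain ⟨a, ha⟩ := s.exists_maximal hne
  obtain ⟨A₀, B₀, hA₀, hB₀, hs₀⟩ := ih (s.erase a) (Finset.erase_ssubset ha.prop)
    fun x hx y hy z hz => h x (Finset.mem_of_mem_erase hx) y (Finset.mem_of_mem_erase hy) z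
      (Finset.mem_of_mem_erase hz)
  -- The inductive chains merely cover `s.erase a`; trimming makes them finite and keeps them inside
  -- `s`.
  let A := A₀ ∩ (s.erase a : Set α)
  let B := B₀ ∩ (s.erase a : Set α)
  have hA : IsChain (· ≤ ·) A := hA₀.mono Set.inter_subset_left
  have hB : IsChain (· ≤ ·) B := hB₀.mono Set.inter_subset_left
  have hAs : ∀ z ∈ A, z ∈ s ∧ ¬ a ≤ z := fun z hz =>
    ⟨Finset.mem_of_mem_erase hz.2, fun hle =>
      Finset.ne_of_mem_erase hz.2 (le_antisymm (ha.le_of_ge (Finset.mem_of_mem_erase hz.2) hle) hle)⟩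
  have hBs : ∀ z ∈ B, z ∈ s ∧ ¬ a ≤ z := fun z hz =>
    ⟨Finset.mem_of_mem_erase hz.2, fun hle =>
      Finset.ne_of_mem_erase hz.2 (le_antisymm (ha.le_of_ge (Finset.mem_of_mem_erase hz.2) hle) hle)⟩
  have hs : (s : Set α) ⊆ insert a (A ∪ B) := fun z hz => by
    by_cases hza : z = a
    · exact Or.inl hza
    · have hz' : z ∈ (s.erase a : Set α) := Finset.mem_erase.2 ⟨hza, hz⟩
      exact Or.inr ((hs₀ hz').imp (fun h => ⟨h, hz'⟩) fun h => ⟨h, hz'⟩)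
  have hs' : (s : Set α) ⊆ insert a (B ∪ A) := by rwa [Set.union_comm]
  let S := {z ∈ A | ∃ y ∈ B, ¬ z ≤ y ∧ ¬ y ≤ z}
  let T := {z ∈ B | ∃ y ∈ A, ¬ z ≤ y ∧ ¬ y ≤ z}
  have hSf : S.Finite := (s.erase a).finite_toSet.subset fun z hz => hz.1.2
  have hTf : T.Finite := (s.erase a).finite_toSet.subset fun z hz => hz.1.2
  rcases S.eq_empty_or_nonempty with hS | ⟨x₀, hx₀⟩
  -- Here `A ∪ B` is already a chain, so `x = a` will do.
  · refine isChain_insert_of_greatest_incomparable hA hB hs le_rfl fun z hz hzy => ?_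
    exact absurd (show z ∈ S from ⟨hz, hzy⟩) (by simp [hS])
  · obtain ⟨y₀, hy₀, hxy₀⟩ := hx₀.2
    obtain ⟨x, hx, hxmax⟩ := (IsChain.mono (s := S) (fun z hz => hz.1) hA).exists_greatest_of_finite
      hSf ⟨x₀, hx₀⟩
    obtain ⟨y, hy, hymax⟩ := (IsChain.mono (s := T) (fun z hz => hz.1) hB).exists_greatest_of_finite
      hTf ⟨y₀, hy₀, x₀, hx₀.1, hxy₀.symm⟩
    obtain ⟨y₁, hy₁, hxy₁⟩ := hx.2
    obtain ⟨x₁, hx₁, hyx₁⟩ := hy.2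
    -- By the choice of `x` and `y` as greatest they are incomparable, so the maximal element `a`
    -- lies above one of them.
    have hxy : ¬ x ≤ y := fun hle => hyx₁.2 ((hxmax x₁ ⟨hx₁, y, hy.1, hyx₁.symm⟩).trans hle)
    have hyx : ¬ y ≤ x := fun hle => hxy₁.2 ((hymax y₁ ⟨hy₁, x, hx.1, hxy₁.symm⟩).trans hle)
    rcases h a ha.prop x (hAs x hx.1).1 y (hBs y hy.1).1 with h | h | h | h | h | h
    · exact absurd h (hAs x hx.1).2
    · exact isChain_insert_of_greatest_incomparable hA hB hs h fun z hz hzy => hxmax z ⟨hz, hzy⟩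
    · exact absurd h (hBs y hy.1).2
    · exact isChain_insert_of_greatest_incomparable hB hA hs' h fun z hz hzy => hymax z ⟨hz, hzy⟩
    · exact absurd h hxy
    · exact absurd h hyx

end Width

/-! ### Planar diagrams from integer coordinates. -/

section Grid

variable {D : Type u} [Lattice D]

/-- Integer coordinates in which every covering is a unit step give a planar diagram. -/
theorem isPlanarDiagram_of_grid (X Y : D → ℤ) (hX : Monotone X) (hY : Monotone Y)
    (hinj : ∀ a b, X a = X b → Y a = Y b → a = b)
    (hcov : ∀ a b, a ⋖ b → X b = X a + 1 ∧ Y b = Y a ∨ X b = X a ∧ Y b = Y a + 1) :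
    IsPlanarDiagram fun a => ((X a - Y a : ℝ), (X a + Y a : ℝ)) := by
  set f : D → ℝ × ℝ := fun a => ((X a - Y a : ℝ), (X a + Y a : ℝ)) with hf
  have hfe : ∀ {a : D} {p : ℝ × ℝ}, p.1 + p.2 = 2 * X a → p.2 - p.1 = 2 * Y a → f a = p := by
    intro a p h1 h2
    ext
    · simp only [hf]; linarith
    · simp only [hf]; linarith
  have hfinj : Function.Injective f := by
    intro a b hab
    have h1 := congrArg Prod.fst hab
    have h2 := congrArg Prod.snd hab
    simp only [hf] at h1 h2
    apply hinj
    · have : (X a : ℝ) = X b := by linarith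
      exact_mod_cast this
    · have : (Y a : ℝ) = Y b := by linarith
      exact_mod_cast this
  -- a point of an edge is an end, or has exactly one coordinate that is not an integer
  have hseg : ∀ {a b : D} {p : ℝ × ℝ}, a ⋖ b → p ∈ segment ℝ (f a) (f b) →
      (p = f a ∨ p = f b) ∨ ∃ t : ℝ, 0 < t ∧ t < 1 ∧
        ((X b = X a + 1 ∧ Y b = Y a) ∧ p.1 + p.2 = 2 * (X a + t) ∧ p.2 - p.1 = 2 * Y a ∨
          (X b = X a ∧ Y b = Y a + 1) ∧ p.1 + p.2 = 2 * X a ∧ p.2 - p.1 = 2 * (Y a + t)) := by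
    intro a b p hab hp
    rw [segment_eq_image'] at hp
    obtain ⟨t, ⟨h0, h1⟩, rfl⟩ := hp
    rcases h0.eq_or_lt with rfl | h0
    · left; left; simp
    rcases h1.eq_or_lt with rfl | h1
    · left; right; simp
    right
    refine ⟨t, h0, h1, ?_⟩
    rcases hcov a b hab with h | h
    · refine Or.inl ⟨h, ?_, ?_⟩ <;> simp [hf, h.1, h.2] <;> ring
    · refine Or.inr ⟨h, ?_, ?_⟩ <;> simp [hf, h.1, h.2] <;> ring
  have hint : ∀ {m n : ℤ} {t : ℝ}, 0 < t → t < 1 → (m : ℝ) ≠ n + t := by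
    intro m n t h0 h1 h
    have h2 : (n : ℝ) < m := by linarith
    have h3 : (m : ℝ) < n + 1 := by linarith
    norm_cast at h2 h3
    omega
  have hvertex : ∀ {a b x : D}, a ⋖ b → f x ∈ segment ℝ (f a) (f b) → x = a ∨ x = b := by
    intro a b x hab hx
    rcases hseg hab hx with (h | h) | ⟨t, h0, h1, ⟨-, h2, -⟩ | ⟨-, -, h2⟩⟩
    · exact Or.inl (hfinj h)
    · exact Or.inr (hfinj h)
    · exact absurd (by simp only [hf] at h2; linarith) (hint (m := X x) (n := X a) h0 h1)
    · exact absurd (by simp only [hf] at h2; linarith) (hint (m := Y x) (n := Y a) h0 h1)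
  refine ⟨hfinj, ?_, fun a b x => hvertex, ?_⟩
  · intro a b hab
    have h1 := hX hab.le
    have h2 := hY hab.le
    have h3 : X a + Y a < X b + Y b := by
      by_contra! h3
      exact hab.ne (hinj a b (by omega) (by omega))
    simp only [hf]
    exact_mod_cast h3
  · rintro a b c d hab hcd hne p ⟨hp, hp'⟩
    rcases hseg hab hp with (rfl | rfl) | ⟨t, h0, h1, h⟩
    · exact ⟨a, ⟨by simp, hvertex hcd hp'⟩, rfl⟩
    · exact ⟨b, ⟨by simp, hvertex hcd hp'⟩, rfl⟩
    rcases hseg hcd hp' with (rfl | rfl) | ⟨t', h0', h1', h'⟩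
    · exact ⟨c, ⟨hvertex hab hp, by simp⟩, rfl⟩
    · exact ⟨d, ⟨hvertex hab hp, by simp⟩, rfl⟩
    -- Two interior points agree. Parallel edges then have the same integer parts, hence coincide;
    -- for perpendicular ones an integer coordinate would be fractional.
    have hfloor : ∀ {m n : ℤ}, (m : ℝ) + t = n + t' → m = n := by
      intro m n hmn
      have h2 : (m : ℝ) < n + 1 := by linarith
      have h3 : (n : ℝ) < m + 1 := by linarith
      norm_cast at h2 h3
      omega
    exfalso
    apply hne
    rcases h with ⟨⟨hb1, hb2⟩, h2, h3⟩ | ⟨⟨hb1, hb2⟩, h2, h3⟩ <;>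
      rcases h' with ⟨⟨hd1, hd2⟩, h2', h3'⟩ | ⟨⟨hd1, hd2⟩, h2', h3'⟩
    · have e1 : X a = X c := hfloor (by linarith)
      have e2 : Y a = Y c := by
        have : (Y a : ℝ) = Y c := by linarith
        exact_mod_cast this
      rw [hinj a c e1 e2, hinj b d (by omega) (by omega)]
    · exact absurd (by linarith) (hint (m := X c) (n := X a) h0 h1)
    · exact absurd (by linarith) (hint (m := X a) (n := X c) h0' h1')
    · have e1 : X a = X c := by
        have : (X a : ℝ) = X c := by linarith
        exact_mod_cast this
      have e2 : Y a = Y c := hfloor (by linarith)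
      rw [hinj a c e1 e2, hinj b d (by omega) (by omega)]

end Grid

/-! ### Counting along a chain. -/

section Count

variable {D : Type u} [PartialOrder D] [Finite D]

/-- The number of elements of `C` below `a`. -/
noncomputable def countBelow (C : Set D) (a : D) : ℤ := ({j ∈ C | j ≤ a} : Set D).ncard

theorem countBelow_mono (C : Set D) : Monotone (countBelow C) := fun a b hab => by
  unfold countBelow
  have hsub : ({j ∈ C | j ≤ a} : Set D) ⊆ {j ∈ C | j ≤ b} := fun j hj => ⟨hj.1, hj.2.trans hab⟩
  exact_mod_cast Set.ncard_le_ncard hsub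

/-- The sets cut out of a chain by `a` and `b` are initial segments, hence nested, so equal size
forces equality. -/
theorem countBelow_eq_iff {C : Set D} (hC : IsChain (· ≤ ·) C) {a b : D}
    (h : countBelow C a = countBelow C b) {j : D} (hj : j ∈ C) : j ≤ a ↔ j ≤ b := by
  have hcard : ({j ∈ C | j ≤ a} : Set D).ncard = ({j ∈ C | j ≤ b} : Set D).ncard := by
    unfold countBelow at h
    exact_mod_cast h
  have heq : ({j ∈ C | j ≤ a} : Set D) = {j ∈ C | j ≤ b} := by
    by_cases hsub : ({j ∈ C | j ≤ a} : Set D) ⊆ {j ∈ C | j ≤ b}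
    · exact Set.eq_of_subset_of_ncard_le hsub hcard.ge
    · obtain ⟨i, hi, hi'⟩ := Set.not_subset.1 hsub
      suffices hsub' : ({j ∈ C | j ≤ b} : Set D) ⊆ {j ∈ C | j ≤ a} from
        (Set.eq_of_subset_of_ncard_le hsub' hcard.le).symm
      refine fun k hk => ⟨hk.1, ?_⟩
      rcases eq_or_ne k i with rfl | hne
      · exact hi.2
      · rcases hC hk.1 hi.1 hne with hki | hik
        · exact hki.trans hi.2
        · exact absurd ⟨hi.1, hik.trans hk.2⟩ hi'
  have hmem : j ∈ ({j ∈ C | j ≤ a} : Set D) ↔ j ∈ ({j ∈ C | j ≤ b} : Set D) := by rw [heq]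
  exact ⟨fun h' => (hmem.1 ⟨hj, h'⟩).2, fun h' => (hmem.2 ⟨hj, h'⟩).2⟩

theorem countBelow_of_unique_new {C : Set D} {a b j : D} (hab : a ≤ b) (hja : ¬ j ≤ a) (hjb : j ≤ b)
    (hj : ∀ i ∈ C, i ≤ b → i ≤ a ∨ i = j) :
    (j ∈ C → countBelow C b = countBelow C a + 1) ∧
      (j ∉ C → countBelow C b = countBelow C a) := by
  constructor
  · intro hjC
    have : ({i ∈ C | i ≤ b} : Set D) = insert j {i ∈ C | i ≤ a} := by
      ext i
      constructor
      · rintro ⟨hi, hib⟩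
        exact (hj i hi hib).elim (fun h => Or.inr ⟨hi, h⟩) Or.inl
      · rintro (rfl | ⟨hi, hia⟩)
        · exact ⟨hjC, hjb⟩
        · exact ⟨hi, hia.trans hab⟩
    unfold countBelow
    rw [this, Set.ncard_insert_of_notMem fun h => hja h.2]
    push_cast
    rfl
  · intro hjC
    refine le_antisymm ?_ (countBelow_mono C hab)
    unfold countBelow
    refine Int.ofNat_le.2 (Set.ncard_le_ncard fun i hi => ⟨hi.1, ?_⟩)
    exact (hj i hi.1 hi.2).resolve_right fun h => hjC (h ▸ hi.1)

end Count

/-! ### The grid embedding of a distributive lattice. -/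

section Planar

variable {D : Type u} [DistribLattice D] [BoundedOrder D] [Finite D]

theorem le_of_forall_supIrred_le {a b : D} (h : ∀ j, SupIrred j → j ≤ a → j ≤ b) : a ≤ b := by
  obtain ⟨s, rfl, hs⟩ := exists_supIrred_decomposition a
  exact Finset.sup_le fun j hj => h j (hs hj) (Finset.le_sup (f := id) hj)

/-- Two new join-irreducibles each give `b` when joined to `a`, so by join-primeness each lies below
the other. -/
theorem exists_supIrred_of_covBy {a b : D} (h : a ⋖ b) :
    ∃ j, SupIrred j ∧ j ≤ b ∧ ¬ j ≤ a ∧ ∀ i, SupIrred i → i ≤ b → i ≤ a ∨ i = j := by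
  obtain ⟨j, hj, hjb, hja⟩ : ∃ j, SupIrred j ∧ j ≤ b ∧ ¬ j ≤ a := by
    by_contra! hc
    exact h.lt.not_ge (le_of_forall_supIrred_le hc)
  refine ⟨j, hj, hjb, hja, fun i hi hib => or_iff_not_imp_left.2 fun hia => ?_⟩
  have hsup : ∀ {x}, x ≤ b → ¬ x ≤ a → a ⊔ x = b := fun {x} h1 h2 =>
    (h.eq_or_eq le_sup_left (sup_le h.le h1)).resolve_left fun h3 => h2 (h3 ▸ le_sup_right)
  exact le_antisymm
    ((hi.supPrime.le_sup.1 (hib.trans (hsup hjb hja).ge)).resolve_left hia)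
    ((hj.supPrime.le_sup.1 (hjb.trans (hsup hib hia).ge)).resolve_left hja)

/-- A finite distributive lattice without three pairwise incomparable join-irreducible elements is
planar. -/
theorem isPlanar_of_not_antichain_three
    (h : ∀ p q r : D, SupIrred p → SupIrred q → SupIrred r →
      p ≤ q ∨ q ≤ p ∨ p ≤ r ∨ r ≤ p ∨ q ≤ r ∨ r ≤ q) : IsPlanar D := by
  classical
  have hfin : {j : D | SupIrred j}.Finite := Set.toFinite _
  obtain ⟨A, B, hA, hB, hAB⟩ := exists_two_chains hfin.toFinset (by
    simp only [Set.Finite.mem_toFinset, Set.mem_ofPred_eq]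
    exact fun x hx y hy z hz => h x y z hx hy hz)
  rw [Set.Finite.coe_toFinset] at hAB
  let C := {j : D | SupIrred j ∧ j ∈ A}
  -- `C` and `C'` must be disjoint, so that a covering raises exactly one coordinate.
  let C' := {j : D | SupIrred j ∧ j ∉ A}
  have hC : IsChain (· ≤ ·) C := hA.mono fun j hj => hj.2
  have hC' : IsChain (· ≤ ·) C' := hB.mono fun j hj => (hAB hj.1).resolve_left hj.2
  refine ⟨inferInstance, _, isPlanarDiagram_of_grid (countBelow C) (countBelow C')
    (countBelow_mono C) (countBelow_mono C') ?_ ?_⟩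
  · intro a b h1 h2
    have key : ∀ j, SupIrred j → (j ≤ a ↔ j ≤ b) := fun j hj => by
      by_cases hjA : j ∈ A
      · exact countBelow_eq_iff hC h1 ⟨hj, hjA⟩
      · exact countBelow_eq_iff hC' h2 ⟨hj, hjA⟩
    exact le_antisymm (le_of_forall_supIrred_le fun j hj => (key j hj).1)
      (le_of_forall_supIrred_le fun j hj => (key j hj).2)
  · intro a b hab
    obtain ⟨j, hj, hjb, hja, hall⟩ := exists_supIrred_of_covBy hab
    have h1 := countBelow_of_unique_new (C := C) hab.le hja hjb fun i hi => hall i hi.1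
    have h2 := countBelow_of_unique_new (C := C') hab.le hja hjb fun i hi => hall i hi.1
    by_cases hjA : j ∈ A
    · exact Or.inl ⟨h1.1 ⟨hj, hjA⟩, h2.2 fun h => h.2 hjA⟩
    · exact Or.inr ⟨h1.2 fun h => hjA h.2, h2.1 ⟨hj, hjA⟩⟩

end Planar

/-! ### From finite lattices to algebras in given universes. -/

section Transfer

/-- The signature of lattices in an arbitrary universe. -/
def liftedLatticeLanguage : FirstOrder.Language.{w, 0} :=
  ⟨fun n => ULift.{w} (LatticeOp n), fun _ => Empty⟩

/-- The lattice operations of `K`, transported along a bijection. -/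
abbrev transportedStructure {K : Type k} [Lattice K] {A : Type v} (e : K ≃ A) :
    liftedLatticeLanguage.{w}.Structure A where
  funMap := fun {n} f x => e (FirstOrder.Language.Structure.funMap (L := latticeLanguage) (n := n)
    (ULift.down f) (e.symm ∘ x))
  RelMap := fun {_} r => Empty.elim r

theorem Represents.transport {K : Type k} [Lattice K] {A : Type v} (e : K ≃ A) {D : Type u}
    [Lattice D] {Q : Set D} (h : Represents latticeLanguage K Q) :
    @Represents liftedLatticeLanguage.{w} A (transportedStructure e) D _ Q := by
  let _ := transportedStructure.{v, w, k} e
  obtain ⟨φ, rfl⟩ := h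
  have hto : ∀ s : Setoid K, IsCongruence latticeLanguage K s →
      IsCongruence liftedLatticeLanguage.{w} A (s.comap e.symm) := by
    intro s hs n f x y hxy
    rw [Setoid.comap_rel]
    change s (e.symm (e _)) (e.symm (e _))
    rw [e.symm_apply_apply, e.symm_apply_apply]
    exact hs n f.down _ _ hxy
  have hfrom : ∀ s : Setoid A, IsCongruence liftedLatticeLanguage.{w} A s →
      IsCongruence latticeLanguage K (s.comap e) := by
    intro s hs n f x y hxy
    have h := hs n (ULift.up f) (e ∘ x) (e ∘ y) hxy
    change s (e (FirstOrder.Language.Structure.funMap (L := latticeLanguage) f (e.symm ∘ e ∘ x)))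
      (e (FirstOrder.Language.Structure.funMap (L := latticeLanguage) f (e.symm ∘ e ∘ y))) at h
    rw [← Function.comp_assoc, ← Function.comp_assoc, e.symm_comp_self] at h
    exact h
  let ψ : Congr liftedLatticeLanguage.{w} A ≃o Congr latticeLanguage K :=
    { toFun := fun s => ⟨s.1.comap e, hfrom s.1 s.2⟩
      invFun := fun s => ⟨s.1.comap e.symm, hto s.1 s.2⟩
      left_inv := fun s => Subtype.ext (Setoid.ext fun x y => by simp [Setoid.comap_rel])
      right_inv := fun s => Subtype.ext (Setoid.ext fun x y => by simp [Setoid.comap_rel])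
      map_rel_iff' := by
        intro s t
        constructor
        · intro hst x y hxy
          have := hst (x := e.symm x) (y := e.symm y)
            (by simpa [Setoid.comap_rel] using hxy)
          simpa [Setoid.comap_rel] using this
        · intro hst x y hxy
          exact hst hxy }
  have hψ : ∀ a b, ψ (con liftedLatticeLanguage.{w} (e a) (e b)) = con latticeLanguage a b := by
    intro a b
    apply le_antisymm
    · rw [← OrderIso.le_symm_apply, con_le_iff]
      change (con latticeLanguage a b).1 (e.symm (e a)) (e.symm (e b))
      simpa using con_rel a b
    · rw [con_le_iff]
      exact con_rel (e a) (e b)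
  refine ⟨ψ.trans φ, ?_⟩
  ext d
  constructor
  · rintro ⟨_, ⟨a, b, rfl⟩, rfl⟩
    exact ⟨_, ⟨e a, e b, rfl⟩, congrArg φ (hψ a b)⟩
  · rintro ⟨_, ⟨a, b, rfl⟩, rfl⟩
    refine ⟨_, ⟨e.symm a, e.symm b, rfl⟩, congrArg φ ?_⟩
    rw [← hψ, e.apply_symm_apply, e.apply_symm_apply]
    rfl

theorem FullyFiniteLatticeRepresentable.fullyAlgebraRepresentable {D : Type u} [Lattice D]
    [BoundedOrder D] (h : FullyFiniteLatticeRepresentable.{u, k} D) :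
    FullyAlgebraRepresentable.{u, v, w} D := by
  intro Q hQ
  obtain ⟨K, _, _, _, hK⟩ := h Q hQ
  -- Finiteness lets `K` be copied into any universe, through `Fin n`.
  obtain ⟨n, ⟨e⟩⟩ := Finite.exists_equiv_fin K
  let e' : K ≃ ULift.{v} (Fin n) := e.trans Equiv.ulift.symm
  exact ⟨liftedLatticeLanguage, fun _ => inferInstanceAs (IsEmpty Empty), ULift (Fin n),
    e'.symm.nonempty, transportedStructure e', hK.transport e'⟩

end Transfer

end PrincRep

theorem theorem1p3 (D : Type u) [DistribLattice D] [BoundedOrder D] [Finite D] :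
    (PrincRep.FullyAlgebraRepresentable.{u, v, w} D →
      PrincRep.IsPlanar D ∧ {c : D | IsCoatom c ∧ PrincRep.JoinReducible c}.Subsingleton) ∧
    (PrincRep.FullyFiniteLatticeRepresentable.{u, k} D →
      PrincRep.FullyAlgebraRepresentable.{u, v, w} D) :=
  ⟨fun h => ⟨PrincRep.isPlanar_of_not_antichain_three fun _ _ _ => h.not_antichain_three,
    h.subsingleton_joinReducible_coatom⟩, fun h => h.fullyAlgebraRepresentable⟩
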